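/- Let $K$ be a bounded convex set in $\mathbb R^n$, $n\ge 2$, with non-empty interior. For a (full-rank) lattice $\Lambda\subset\mathbb R^n$ and a finite set $T\subset\mathbb R^n$, the family $\mathcal F=K+\Lambda+T=\{K+v+t : v\in\Lambda,\ t\in T\}$ is called a periodic arrangement of translates of $K$; its density is $\delta(\mathcal F)=|T|\,\mathrm{vol}(K)/\det\Lambda$, and it is a covering of $\mathbb R^n$ if $\bigcup\mathcal F=\mathbb R^n$. Let the periodic translative covering density $\theta(K)\in[0,\infty]$ be the infimum of the densities of all periodic coverings of $\mathbb R^n$ by translates of $K$ (with $\inf\emptyset=\infty$). Then $$\theta(K)\le n\ln n+n\ln\ln n+5n .$$ -/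

import Mathlib

open MeasureTheory
open scoped Pointwise ENNReal

/-- The periodic arrangement `K + Λ + T`: the family of the translates `K + v + t` of `K`, where
`v` runs through `Λ` and `t` through the finite set `T`. -/
def periodicArrangement {n : ℕ} (K : Set (EuclideanSpace ℝ (Fin n)))
    (Λ : Submodule ℤ (EuclideanSpace ℝ (Fin n))) (T : Finset (EuclideanSpace ℝ (Fin n))) :
    Λ × T → Set (EuclideanSpace ℝ (Fin n)) :=
  fun p => ((p.1 : EuclideanSpace ℝ (Fin n)) + (p.2 : EuclideanSpace ℝ (Fin n))) +ᵥ K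

/-- The density `|T| vol(K) / det Λ` of the periodic arrangement `K + Λ + T`. For a full-rank
lattice `Λ` the covolume is `det Λ`, a positive real number. -/
noncomputable def periodicDensity {n : ℕ} (K : Set (EuclideanSpace ℝ (Fin n)))
    (Λ : Submodule ℤ (EuclideanSpace ℝ (Fin n))) (T : Finset (EuclideanSpace ℝ (Fin n))) : ℝ≥0∞ :=
  (T.card : ℝ≥0∞) * volume K / ENNReal.ofReal (ZLattice.covolume Λ)

/-- The periodic translative covering density `θ(K)`: the infimum of the densities of the periodic
arrangements `K + Λ + T`, with `Λ` a full-rank lattice and `T` a finite set, that cover the whole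
space. It is taken in `[0, ∞]`, so it is `∞` if there is no such covering. -/
noncomputable def periodicCoveringDensity {n : ℕ} (K : Set (EuclideanSpace ℝ (Fin n))) : ℝ≥0∞ :=
  sInf {d : ℝ≥0∞ | ∃ (Λ : Submodule ℤ (EuclideanSpace ℝ (Fin n))) (_ : DiscreteTopology Λ)
    (_ : IsZLattice ℝ Λ) (T : Finset (EuclideanSpace ℝ (Fin n))),
    (⋃ p, periodicArrangement K Λ T p) = Set.univ ∧ d = periodicDensity K Λ T}

/-! This is Rogers' random covering argument, run on a torus. Let `W` be `K`, recentred and shrunk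
by `1 + η`, and let `Λ` be so sparse that `W` embeds in the quotient; let `p` be the fraction of the
torus that `W` fills. About `n log(1/η) / p` well-chosen translates of `W` leave at most the
fraction `η ^ n` uncovered. Pack translates of `-ηW` into the rest: by volume at most `1 / p` fit.
If the packing is maximal, each `x - ηW` meets a chosen translate of `W` or a packed set, so `x`
lies in an `(1 + η)W`-translate; the packed case needs `η(W - W) ⊆ (1 + η)W`, which follows from `-W
⊆ nW` (Minkowski–Radon) and `ηn ≤ 1`. The density is at most `(1 + η) ^ n (n log(1/η) + 2)`. -/

/-! ### Asymmetry of convex bodies -/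

/-- **Minkowski–Radon**: a compact convex set `K` of dimension `n` has a point `c` such that
`-(K - c) ⊆ n (K - c)`. -/
theorem Convex.exists_forall_reflection_mem {E : Type*} [AddCommGroup E] [Module ℝ E]
    [TopologicalSpace E] [T2Space E] [IsTopologicalAddGroup E] [ContinuousSMul ℝ E]
    [FiniteDimensional ℝ E] {K : Set E} (hK : Convex ℝ K) (hc : IsCompact K)
    (hn : 0 < Module.finrank ℝ E) :
    ∃ c : E, ∀ x ∈ K, (Module.finrank ℝ E : ℝ)⁻¹ •
      (((Module.finrank ℝ E : ℝ) + 1) • c - x) ∈ K := by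
  set n := Module.finrank ℝ E with hn_def
  have hn0 : (0 : ℝ) < n := by exact_mod_cast hn
  have hn1 : (0 : ℝ) < n + 1 := by positivity
  -- `F x` is the set of centres suitable for the single point `x`; Helly's theorem yields a common
  -- one.
  let F : K → Set E := fun x => (fun y => ((n : ℝ) + 1)⁻¹ • ((n : ℝ) • y + (x : E))) '' K
  have hF : ∀ (x : K) (c : E), c ∈ F x ↔ (n : ℝ)⁻¹ • (((n : ℝ) + 1) • c - x) ∈ K := by
    intro x c
    constructor
    · rintro ⟨y, hy, rfl⟩
      simpa [smul_smul, hn1.ne', hn0.ne'] using hy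
    · intro h
      exact ⟨_, h, by simp [smul_smul, hn1.ne', hn0.ne']⟩
  have hconv : ∀ x, Convex ℝ (F x) := by
    intro x c hc d hd a b ha hb hab
    rw [hF] at hc hd ⊢
    have := hK hc hd ha hb hab
    have hb' : b = 1 - a := by linarith
    convert this using 1
    subst hb'
    module
  have hcomp : ∀ x, IsCompact (F x) := fun x => hc.image (by fun_prop)
  have hint : ∀ I : Finset K, I.card ≤ n + 1 → (⋂ i ∈ I, F i).Nonempty := by
    classical
    intro I hI
    rcases I.eq_empty_or_nonempty with rfl | hne
    · simp
    have hm : (0 : ℝ) < I.card := by exact_mod_cast hne.card_pos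
    have hI' : (I.card : ℝ) ≤ n + 1 := by exact_mod_cast hI
    -- The centroid works: the weights in `key` are nonnegative exactly because `I.card ≤ n + 1`.
    refine ⟨(I.card : ℝ)⁻¹ • ∑ j ∈ I, (j : E), ?_⟩
    simp only [Set.mem_iInter]
    intro i hi
    rw [hF]
    have key : (n : ℝ)⁻¹ • (((n : ℝ) + 1) • (I.card : ℝ)⁻¹ • ∑ j ∈ I, (j : E) - i) =
        ∑ j ∈ I, ((n : ℝ)⁻¹ * (((n : ℝ) + 1) * (I.card : ℝ)⁻¹ - if j = i then 1 else 0)) •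
          (j : E) := by
      simp only [mul_smul, sub_smul, ite_smul, one_smul, zero_smul, ← Finset.smul_sum,
        Finset.sum_sub_distrib, Finset.sum_ite_eq', hi, if_true]
    rw [key]
    refine hK.sum_mem ?_ ?_ fun j _ => j.2
    · intro j _
      have : 1 ≤ ((n : ℝ) + 1) * (I.card : ℝ)⁻¹ := by
        rw [← div_eq_mul_inv, le_div_iff₀ hm]; linarith
      refine mul_nonneg (by positivity) ?_
      split_ifs <;> linarith
    · rw [← Finset.mul_sum, Finset.sum_sub_distrib]
      simp [hi]
      field_simp
      ring
  obtain ⟨c, hc⟩ := Convex.helly_theorem_compact' (𝕜 := ℝ) hconv hcomp hint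
  refine ⟨c, fun x hx => (hF ⟨x, hx⟩ c).1 (Set.mem_iInter.1 hc ⟨x, hx⟩)⟩

/-! ### Covering the torus -/

/-- If every translate `{x | y - x ∈ P}` meets `F` in measure `c`, then `N` suitable translates of
`P` leave at most the fraction `(1 - c / μ F) ^ N` of `F` uncovered. -/
theorem exists_finset_measure_uncovered_le {G : Type*} [AddCommGroup G] [MeasurableSpace G]
    [MeasurableSub₂ G] (μ : Measure G) [SFinite μ] {F P : Set G} (hF : MeasurableSet F)
    (hP : MeasurableSet P) (hF0 : μ F ≠ 0) (hFt : μ F ≠ ⊤) {c : ℝ≥0∞}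
    (hc : ∀ y, μ ({x | y - x ∈ P} ∩ F) = c) (N : ℕ) :
    ∃ T : Finset G, T.card ≤ N ∧
      μ ({y | ∀ x ∈ T, y - x ∉ P} ∩ F) ≤ μ F * (1 - c / μ F) ^ N := by
  classical
  induction N with
  | zero => exact ⟨∅, by simp, by simp⟩
  | succ N ih =>
    obtain ⟨T, hT, hle⟩ := ih
    set U : Set G := {y | ∀ x ∈ T, y - x ∉ P} ∩ F with hU
    have hUm : MeasurableSet U := by
      refine MeasurableSet.inter ?_ hF
      have : {y | ∀ x ∈ T, y - x ∉ P} = ⋂ x ∈ T, (fun y => y - x) ⁻¹' Pᶜ := by ext; simp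
      rw [this]
      exact Finset.measurableSet_biInter _ fun x _ => (measurable_sub_const x) hP.compl
    have hD : MeasurableSet {z : G × G | z.2 - z.1 ∉ P} :=
      (measurable_snd.sub measurable_fst) hP.compl
    -- Tonelli: each `y ∈ U` is missed by the translates at `x` in a set of measure `μ F - c`; some
    -- `x` does no worse than average.
    have hswap : ∫⁻ x in F, μ ({y | y - x ∉ P} ∩ U) ∂μ = μ U * (μ F - c) := by
      have h1 : ∀ x, μ ({y | y - x ∉ P} ∩ U) =
          ∫⁻ y in U, {z : G × G | z.2 - z.1 ∉ P}.indicator 1 (x, y) ∂μ := by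
        intro x
        have hm : MeasurableSet {y | y - x ∉ P} := (measurable_sub_const x) hP.compl
        rw [← Measure.restrict_apply hm, ← lintegral_indicator_one hm]
        rfl
      simp_rw [h1]
      rw [lintegral_lintegral_swap]
      · have h2 : ∀ y, ∫⁻ x in F, {z : G × G | z.2 - z.1 ∉ P}.indicator 1 (x, y) ∂μ =
            μ F - c := by
          intro y
          have hm : MeasurableSet {x | y - x ∈ P} := (measurable_const_sub y) hP
          have h3 : ∫⁻ x in F, {z : G × G | z.2 - z.1 ∉ P}.indicator 1 (x, y) ∂μ =
              μ.restrict F {x | y - x ∈ P}ᶜ := by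
            rw [← lintegral_indicator_one hm.compl]
            rfl
          rw [h3, Measure.restrict_apply hm.compl, ← hc y, Set.inter_comm, Set.inter_comm _ F,
            ← Set.sdiff_eq, ← Set.sdiff_inter_self_eq_sdiff, Set.inter_comm _ F,
            measure_sdiff Set.inter_subset_left (hF.inter hm).nullMeasurableSet
              (measure_ne_top_of_subset Set.inter_subset_left hFt)]
        simp_rw [h2]
        rw [lintegral_const, Measure.restrict_apply_univ, mul_comm]
      · exact (measurable_one.indicator hD).aemeasurable
    have hmeas : Measurable fun x => μ ({y | y - x ∉ P} ∩ U) := by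
      have := measurable_measure_prodMk_left (ν := μ.restrict U) hD
      convert this using 2 with x
      exact (Measure.restrict_apply ((measurable_sub_const x) hP.compl)).symm
    obtain ⟨x, -, hx⟩ := exists_le_setLAverage hF0 hFt hmeas.aemeasurable
    rw [setLAverage_eq, hswap] at hx
    refine ⟨insert x T, (Finset.card_insert_le _ _).trans (by omega), ?_⟩
    have hset : {y | ∀ z ∈ insert x T, y - z ∉ P} ∩ F = {y | y - x ∉ P} ∩ U := by
      ext y; simp [hU, and_assoc]
    rw [hset]
    refine hx.trans ?_
    rw [mul_div_assoc, ENNReal.sub_div (fun _ _ => hF0), ENNReal.div_self hF0 hFt, pow_succ,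
      ← mul_assoc]
    gcongr

/-- A set with disjoint translates modulo a lattice meets the fundamental domain, after
periodization, in its own measure. -/
theorem MeasureTheory.IsAddFundamentalDomain.measure_iUnion_vadd_inter {E : Type*}
    [NormedAddCommGroup E] [NormedSpace ℝ E] [MeasurableSpace E] [BorelSpace E]
    {Λ : Submodule ℤ E} [Countable Λ] {μ : Measure E} [μ.IsAddLeftInvariant]
    {F A : Set E} (hF : IsAddFundamentalDomain Λ F μ) (hFm : MeasurableSet F)
    (hA : MeasurableSet A) (hd : Pairwise fun v w : Λ => Disjoint ((v : E) +ᵥ A) ((w : E) +ᵥ A)) :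
    μ ((⋃ v : Λ, (v : E) +ᵥ A) ∩ F) = μ A := by
  have : MeasurableVAdd Λ E := (inferInstance : MeasurableVAdd Λ.toAddSubgroup E)
  have : VAddInvariantMeasure Λ E μ := (inferInstance : VAddInvariantMeasure Λ.toAddSubgroup E μ)
  rw [hF.measure_eq_tsum A, Set.iUnion_inter, measure_iUnion]
  · rfl
  · exact fun v w h => (hd h).mono Set.inter_subset_left Set.inter_subset_left
  · exact fun v => (hA.const_vadd _).inter hFm

theorem Submodule.pairwise_disjoint_vadd {E : Type*} [AddCommGroup E] {Λ : Submodule ℤ E}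
    {A : Set E} (h : ∀ v ∈ Λ, ∀ a ∈ A, ∀ b ∈ A, v = a - b → v = 0) :
    Pairwise fun v w : Λ => Disjoint ((v : E) +ᵥ A) ((w : E) +ᵥ A) := by
  intro v w hvw
  rw [Set.disjoint_left]
  rintro _ ⟨a, ha, rfl⟩ ⟨b, hb, hab⟩
  apply hvw
  have hab' : (w : E) + b = v + a := hab
  have := h (v - w) (Λ.sub_mem v.2 w.2) b hb a ha (by
    rw [sub_eq_sub_iff_add_eq_add, add_comm b, hab'])
  exact Subtype.ext (sub_eq_zero.1 this)

/-- Random translates of `W` modulo `Λ`, completed by a maximal packing of translates of `-η W` in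
the uncovered part, cover the space once `W` is enlarged to `(1 + η) W`. -/
theorem exists_finset_cover_of_neg_smul_subset {E : Type*} [NormedAddCommGroup E]
    [NormedSpace ℝ E] [FiniteDimensional ℝ E] [MeasurableSpace E] [BorelSpace E] {μ : Measure E}
    [μ.IsAddHaarMeasure] {Λ : Submodule ℤ E} [Countable Λ] {F W : Set E}
    (hF : IsAddFundamentalDomain Λ F μ) (hFm : MeasurableSet F) (hFt : μ F ≠ ⊤)
    (hW : IsOpen W) (hconv : Convex ℝ W) (hne : W.Nonempty) {m : ℝ} (hm : 0 < m)
    (hneg : ∀ w ∈ W, -(m⁻¹ • w) ∈ W)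
    (hinj : ∀ v ∈ Λ, ∀ a ∈ W, ∀ b ∈ W, v = a - b → v = 0)
    {η : ℝ} (hη : 0 < η) (hη1 : η ≤ 1) (hηm : η * m ≤ 1) (N : ℕ) :
    ∃ T S : Finset E, T.card ≤ N ∧
      S.card * (ENNReal.ofReal (η ^ Module.finrank ℝ E) * μ W) ≤ μ F * (1 - μ W / μ F) ^ N ∧
      ∀ x, ∃ t ∈ (T : Set E) ∪ S, ∃ v ∈ Λ, x - v - t ∈ (1 + η) • W := by
  classical
  have hF0 : μ F ≠ 0 := by
    have : MeasurableVAdd Λ E := (inferInstance : MeasurableVAdd Λ.toAddSubgroup E)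
    have : VAddInvariantMeasure Λ E μ := (inferInstance : VAddInvariantMeasure Λ.toAddSubgroup E μ)
    exact hF.measure_ne_zero (NeZero.ne μ)
  have h0 : (0 : E) ∈ W := by
    obtain ⟨w, hw⟩ := hne
    have := hconv hw (hneg w hw) (a := 1 / (1 + m)) (b := m / (1 + m)) (by positivity)
      (by positivity) (by field_simp)
    convert this using 1
    rw [smul_neg, smul_smul, ← sub_eq_add_neg, ← sub_smul]
    have : 1 / (1 + m) - m / (1 + m) * m⁻¹ = 0 := by field_simp; ring
    rw [this, zero_smul]
  have hηW : ∀ w ∈ W, η • w ∈ W := fun w hw => hconv.smul_mem_of_zero_mem h0 hw ⟨hη.le, hη1⟩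
  have hadd : ∀ a ∈ W, ∀ b ∈ W, a + η • b ∈ (1 + η) • W := by
    intro a ha b hb
    rw [hconv.add_smul zero_le_one hη.le, one_smul]
    exact Set.add_mem_add ha (Set.smul_mem_smul_set hb)
  have hsub : ∀ a ∈ W, ∀ b ∈ W, η • (a - b) ∈ (1 + η) • W := by
    intro a ha b hb
    -- `W - W ⊆ W + mW = (1 + m)W`, and `η(1 + m) ≤ 1 + η`.
    have h1 : a - b ∈ (1 + m) • W := by
      rw [hconv.add_smul zero_le_one hm.le, one_smul, sub_eq_add_neg]
      refine Set.add_mem_add ha ⟨_, hneg b hb, ?_⟩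
      simp [smul_smul, hm.ne']
    obtain ⟨c, hc, hcab⟩ := h1
    simp only at hcab
    rw [← hcab, smul_smul]
    refine ⟨(η * (1 + m) / (1 + η)) • c, hconv.smul_mem_of_zero_mem h0 hc
      ⟨by positivity, (div_le_one (by positivity)).2 (by linarith)⟩, ?_⟩
    simp only [smul_smul]
    congr 1
    field_simp
  set P : Set E := ⋃ v : Λ, (v : E) +ᵥ W with hPdef
  have hmemP : ∀ z, z ∈ P ↔ ∃ v ∈ Λ, z - v ∈ W := by
    intro z
    simp [hPdef, Set.mem_vadd_set_iff_neg_vadd_mem, sub_eq_neg_add]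
  have hPo : IsOpen P := isOpen_iUnion fun v => hW.vadd _
  have hc : ∀ y, μ ({x | y - x ∈ P} ∩ F) = μ W := by
    intro y
    have hA : MeasurableSet (y +ᵥ -W) := (hW.neg.vadd y).measurableSet
    have hd := hF.measure_iUnion_vadd_inter hFm hA (Submodule.pairwise_disjoint_vadd (by
      rintro v hv _ ⟨a, ha, rfl⟩ _ ⟨b, hb, rfl⟩ h
      refine hinj v hv _ hb _ ha ?_
      rw [h]; simp only [vadd_eq_add]; abel))
    rw [measure_vadd, Measure.measure_neg] at hd
    rw [← hd]
    congr 2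
    ext x
    simp only [Set.mem_ofPred_eq, hmemP, Set.mem_iUnion, Set.mem_vadd_set_iff_neg_vadd_mem,
      Set.mem_neg, vadd_eq_add, Subtype.exists, exists_prop]
    constructor
    · rintro ⟨v, hv, h⟩
      refine ⟨-v, Λ.neg_mem hv, ?_⟩
      convert h using 1; abel
    · rintro ⟨v, hv, h⟩
      refine ⟨-v, Λ.neg_mem hv, ?_⟩
      convert h using 1; abel
  obtain ⟨T, hT, hTle⟩ :=
    exists_finset_measure_uncovered_le μ hFm hPo.measurableSet hF0 hFt hc N
  -- The sets `y - ηW` avoid the part already covered and are disjoint modulo `Λ` for distinct `y`.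
  let good : Finset E → Prop := fun S =>
    (∀ y ∈ S, ∀ w ∈ W, ∀ t ∈ T, y - η • w - t ∉ P) ∧
    ∀ y ∈ S, ∀ y' ∈ S, ∀ w ∈ W, ∀ w' ∈ W, (y - η • w) - (y' - η • w') ∈ Λ → y = y'
  have hgood : ∀ S, good S →
      S.card * (ENNReal.ofReal (η ^ Module.finrank ℝ E) * μ W) ≤ μ F * (1 - μ W / μ F) ^ N := by
    rintro S ⟨h1, h2⟩
    have hopen : ∀ y : E, IsOpen (y +ᵥ (-η) • W) := fun y => (hW.smul₀ (by linarith)).vadd y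
    have hmem : ∀ y z : E, z ∈ y +ᵥ (-η) • W → ∃ w ∈ W, z = y - η • w := by
      rintro y _ ⟨_, ⟨w, hw, rfl⟩, rfl⟩
      exact ⟨w, hw, by simp [sub_eq_add_neg]⟩
    set A : Set E := ⋃ y ∈ S, y +ᵥ (-η) • W with hAdef
    have hAmem : ∀ z ∈ A, ∃ y ∈ S, ∃ w ∈ W, z = y - η • w := by
      intro z hz
      simp only [hAdef, Set.mem_iUnion] at hz
      obtain ⟨y, hy, hz⟩ := hz
      exact ⟨y, hy, hmem y z hz⟩
    have hAo : IsOpen A := isOpen_biUnion fun y _ => hopen y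
    have hμA : μ A = S.card * (ENNReal.ofReal (η ^ Module.finrank ℝ E) * μ W) := by
      rw [hAdef, measure_biUnion_finset _ fun y _ => (hopen y).measurableSet]
      · simp [Measure.addHaar_smul, abs_pow, abs_of_pos hη]
      · intro y hy y' hy' hne
        rw [Function.onFun, Set.disjoint_left]
        intro z hz hz'
        obtain ⟨w, hw, rfl⟩ := hmem _ _ hz
        obtain ⟨w', hw', h⟩ := hmem _ _ hz'
        exact hne (h2 y hy y' hy' w hw w' hw' (by rw [h, sub_self]; exact Λ.zero_mem))
    have hd := hF.measure_iUnion_vadd_inter hFm hAo.measurableSet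
      (Submodule.pairwise_disjoint_vadd (by
        intro v hv a ha b hb hab
        obtain ⟨y, hy, w, hw, rfl⟩ := hAmem a ha
        obtain ⟨y', hy', w', hw', rfl⟩ := hAmem b hb
        have hyy := h2 y hy y' hy' w hw w' hw' (hab ▸ hv)
        subst hyy
        exact hinj v hv _ (hηW w' hw') _ (hηW w hw) (by rw [hab]; abel)))
    rw [← hμA, ← hd]
    refine (measure_mono (Set.inter_subset_inter_left _ ?_)).trans hTle
    intro z hz t ht hzP
    obtain ⟨v, hzv⟩ := Set.mem_iUnion.1 hz
    obtain ⟨a, ha, rfl⟩ := hzv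
    obtain ⟨y, hy, w, hw, rfl⟩ := hAmem a ha
    refine h1 y hy w hw t ht ?_
    obtain ⟨u, hu, huW⟩ := (hmemP _).1 hzP
    refine (hmemP _).2 ⟨u - v, Λ.sub_mem hu v.2, ?_⟩
    convert huW using 1
    simp only [vadd_eq_add]; abel
  -- Otherwise every good set could be extended, so good sets of every size would exist, against
  -- `hgood`.
  by_contra hcon
  have hstep : ∀ S, good S → ∃ x, x ∉ S ∧ good (insert x S) := by
    intro S hS
    by_contra hno
    push Not at hno
    refine hcon ⟨T, S, hT, hgood S hS, fun x => ?_⟩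
    have h01 : (0 : E) ∈ (1 + η) • W := ⟨0, h0, by simp⟩
    by_cases hx : x ∈ S
    · exact ⟨x, Or.inr hx, 0, Λ.zero_mem, by simpa using h01⟩
    by_contra hunc
    push Not at hunc
    have hP' : ∀ w ∈ W, ∀ t ∈ T, x - η • w - t ∉ P := by
      intro w hw t ht hP
      obtain ⟨v, hv, h⟩ := (hmemP _).1 hP
      refine hunc t (Or.inl ht) v hv ?_
      convert hadd _ h w hw using 1
      abel
    have hxS : ∀ y ∈ S, ∀ w ∈ W, ∀ w' ∈ W, (x - η • w) - (y - η • w') ∉ Λ := by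
      intro y hy w hw w' hw' hv
      refine hunc y (Or.inr hy) _ hv ?_
      convert hsub w hw w' hw' using 1
      rw [smul_sub]; abel
    refine hno x hx ⟨?_, ?_⟩
    · intro y hy
      rcases Finset.mem_insert.1 hy with rfl | hy
      · exact hP'
      · exact hS.1 y hy
    · intro y hy y' hy' w hw w' hw' hv
      rcases Finset.mem_insert.1 hy with hyx | hyS <;>
        rcases Finset.mem_insert.1 hy' with hyx' | hyS'
      · rw [hyx, hyx']
      · rw [hyx] at hv
        exact (hxS y' hyS' w hw w' hw' hv).elim
      · rw [hyx'] at hv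
        refine (hxS y hyS w' hw' w hw ?_).elim
        rw [← neg_sub]; exact Λ.neg_mem hv
      · exact hS.2 y hyS y' hyS' w hw w' hw' hv
  have hall : ∀ k : ℕ, ∃ S, good S ∧ S.card = k := by
    intro k
    induction k with
    | zero => exact ⟨∅, ⟨by simp, by simp⟩, rfl⟩
    | succ k ih =>
      obtain ⟨S, hS, rfl⟩ := ih
      obtain ⟨x, hx, hx'⟩ := hstep S hS
      exact ⟨_, hx', Finset.card_insert_of_notMem hx⟩
  have hpos : ENNReal.ofReal (η ^ Module.finrank ℝ E) * μ W ≠ 0 :=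
    mul_ne_zero (by simpa using pow_pos hη _) (hW.measure_pos μ hne).ne'
  have hfin : μ F * (1 - μ W / μ F) ^ N ≠ ⊤ :=
    ENNReal.mul_ne_top hFt (ENNReal.pow_ne_top (ne_top_of_le_ne_top ENNReal.one_ne_top
      tsub_le_self))
  obtain ⟨k, hk⟩ := ENNReal.exists_nat_mul_gt hpos hfin
  obtain ⟨S, hS, rfl⟩ := hall k
  exact absurd (hgood S hS) (not_le.2 hk)

/-- With `N = ⌈τ / p⌉`, `(1 - p) ^ N ≤ exp(-τ) = η ^ d`. In the constant `2`, one unit pays for the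
rounding, as `p ≤ 1`, and one for the packing. -/
theorem exists_finset_cover_card_mul_le {E : Type*} [NormedAddCommGroup E]
    [NormedSpace ℝ E] [FiniteDimensional ℝ E] [MeasurableSpace E] [BorelSpace E] {μ : Measure E}
    [μ.IsAddHaarMeasure] {Λ : Submodule ℤ E} [Countable Λ] {F W : Set E}
    (hF : IsAddFundamentalDomain Λ F μ) (hFm : MeasurableSet F) (hFt : μ F ≠ ⊤)
    (hW : IsOpen W) (hconv : Convex ℝ W) (hne : W.Nonempty) {m : ℝ} (hm : 0 < m)
    (hneg : ∀ w ∈ W, -(m⁻¹ • w) ∈ W)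
    (hinj : ∀ v ∈ Λ, ∀ a ∈ W, ∀ b ∈ W, v = a - b → v = 0)
    {η : ℝ} (hη : 0 < η) (hη1 : η ≤ 1) (hηm : η * m ≤ 1) :
    ∃ T : Finset E, (∀ x, ∃ t ∈ T, ∃ v ∈ Λ, x - v - t ∈ (1 + η) • W) ∧
      T.card * (μ.real W / μ.real F) ≤ Module.finrank ℝ E * Real.log η⁻¹ + 2 := by
  classical
  set d := Module.finrank ℝ E
  have hWF : μ W ≤ μ F := by
    rw [← hF.measure_iUnion_vadd_inter hFm hW.measurableSet
      (Submodule.pairwise_disjoint_vadd hinj)]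
    exact measure_mono Set.inter_subset_right
  have hWt : μ W ≠ ⊤ := ne_top_of_le_ne_top hFt hWF
  have hWpos : 0 < μ.real W := ENNReal.toReal_pos (hW.measure_pos μ hne).ne' hWt
  have hWF' : μ.real W ≤ μ.real F := ENNReal.toReal_mono hFt hWF
  have hFpos : 0 < μ.real F := hWpos.trans_le hWF'
  set p := μ.real W / μ.real F with hp
  have hp0 : 0 < p := div_pos hWpos hFpos
  have hp1 : p ≤ 1 := (div_le_one hFpos).2 hWF'
  set τ := d * Real.log η⁻¹ with hτ
  have hτ0 : 0 ≤ τ := mul_nonneg (Nat.cast_nonneg _) (Real.log_nonneg (one_le_inv₀ hη |>.2 hη1))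
  obtain ⟨T, S, hT, hS, hcov⟩ := exists_finset_cover_of_neg_smul_subset hF hFm hFt hW hconv hne hm
    hneg hinj hη hη1 hηm ⌈τ / p⌉₊
  set N := ⌈τ / p⌉₊
  have hN1 : τ ≤ N * p := (div_le_iff₀ hp0).1 (Nat.le_ceil _)
  have hN2 : N * p ≤ τ + 1 := by
    have : (N : ℝ) ≤ τ / p + 1 := (Nat.ceil_lt_add_one (by positivity)).le
    calc (N : ℝ) * p ≤ (τ / p + 1) * p := by gcongr
      _ = τ + p := by field_simp
      _ ≤ τ + 1 := by linarith
  have hS' : (S.card : ℝ) * (η ^ d * μ.real W) ≤ μ.real F * (1 - p) ^ N := by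
    have hWF1 : μ W / μ F ≤ 1 := ENNReal.div_le_of_le_mul (by simpa using hWF)
    have := ENNReal.toReal_mono (ENNReal.mul_ne_top hFt (ENNReal.pow_ne_top
      (ne_top_of_le_ne_top ENNReal.one_ne_top tsub_le_self))) hS
    rw [ENNReal.toReal_mul, ENNReal.toReal_mul, ENNReal.toReal_mul, ENNReal.toReal_pow,
      ENNReal.toReal_sub_of_le hWF1 ENNReal.one_ne_top, ENNReal.toReal_div,
      ENNReal.toReal_ofReal (by positivity)] at this
    simpa [Measure.real, hp, d] using this
  have hexp : (1 - p) ^ N ≤ η ^ d := by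
    calc (1 - p) ^ N ≤ Real.exp (-p) ^ N := by
          have := Real.add_one_le_exp (-p)
          exact pow_le_pow_left₀ (by linarith) (by linarith) _
      _ = Real.exp (-(N * p)) := by rw [← Real.exp_nat_mul]; ring_nf
      _ ≤ Real.exp (-τ) := Real.exp_le_exp.2 (by linarith)
      _ = η ^ d := by
          rw [hτ, Real.log_inv, mul_neg, neg_neg, Real.exp_nat_mul, Real.exp_log hη]
  have hηd : 0 < η ^ d := pow_pos hη _
  have hSp : S.card * p ≤ 1 := by
    have h1 : (S.card : ℝ) * (η ^ d * μ.real W) ≤ μ.real F * η ^ d :=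
      hS'.trans (by gcongr)
    rw [hp, ← mul_div_assoc, div_le_one hFpos]
    refine le_of_mul_le_mul_right ?_ hηd
    linarith
  refine ⟨T ∪ S, fun x => ?_, ?_⟩
  · obtain ⟨t, ht, h⟩ := hcov x
    exact ⟨t, by simpa using ht, h⟩
  · have h1 : ((T ∪ S).card : ℝ) ≤ N + S.card := by
      exact_mod_cast (Finset.card_union_le T S).trans (by omega)
    calc ((T ∪ S).card : ℝ) * p ≤ (N + S.card) * p := by gcongr
      _ ≤ τ + 2 := by linarith

/-! ### Choice of the lattice and of `η` -/

/-- A bounded set embeds in the torus of a sufficiently sparse lattice. -/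
theorem Bornology.IsBounded.exists_basis_span_inter_sub {ι : Type*} [Fintype ι]
    {W : Set (EuclideanSpace ℝ ι)} (hW : Bornology.IsBounded W) :
    ∃ b : Module.Basis ι ℝ (EuclideanSpace ℝ ι), ∀ v ∈ Submodule.span ℤ (Set.range b),
      ∀ x ∈ W, ∀ y ∈ W, v = x - y → v = 0 := by
  obtain ⟨r, hr, hWr⟩ := hW.exists_pos_norm_le
  have hR : (0 : ℝ) < 2 * r + 1 := by linarith
  refine ⟨(EuclideanSpace.basisFun ι ℝ).toBasis.unitsSMul fun _ => Units.mk0 _ hR.ne', ?_⟩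
  intro v hv x hx y hy h
  rw [Module.Basis.mem_span_iff_repr_mem] at hv
  ext i
  obtain ⟨k, hk⟩ := hv i
  rw [Module.Basis.repr_unitsSMul] at hk
  have hk' : v i = (2 * r + 1) * k := by
    simp [Units.smul_def] at hk
    rw [hk]; field_simp
  have hvn : |v i| ≤ 2 * r := by
    calc |v i| ≤ ‖v‖ := PiLp.norm_apply_le v i
      _ ≤ ‖x‖ + ‖y‖ := h ▸ norm_sub_le x y
      _ ≤ 2 * r := by linarith [hWr x hx, hWr y hy]
  have hk0 : k = 0 := by
    by_contra hk0
    have : (1 : ℝ) ≤ |(k : ℝ)| := by exact_mod_cast Int.one_le_abs hk0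
    rw [hk', abs_mul, abs_of_pos hR] at hvn
    nlinarith
  simp [hk', hk0]

/-- The choice `η = 1 / (n log n)` (for `n = 2`: `η = 1 / 2`). -/
theorem exists_enlargement_bound (n : ℕ) (hn : 2 ≤ n) :
    ∃ η : ℝ, 0 < η ∧ η ≤ 1 ∧ η * n ≤ 1 ∧
      (1 + η) ^ n * (n * Real.log η⁻¹ + 2) ≤
        n * Real.log n + n * Real.log (Real.log n) + 5 * n := by
  rcases hn.eq_or_lt with rfl | hn3
  · refine ⟨1 / 2, by norm_num, by norm_num, by norm_num, ?_⟩
    have h1 : Real.log (1 / 2) ≤ Real.log (Real.log 2) :=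
      Real.log_le_log (by norm_num) (by linarith [Real.log_two_gt_d9])
    rw [one_div, Real.log_inv] at h1
    have := Real.log_two_lt_d9
    norm_num
    linarith
  · have hn3' : (3 : ℝ) ≤ n := by exact_mod_cast hn3
    have hn0 : (0 : ℝ) < n := by linarith
    set y := Real.log n with hy
    have hy1 : 1 ≤ y := by
      rw [hy, Real.le_log_iff_exp_le hn0]
      linarith [Real.exp_one_lt_d9]
    have hy0 : 0 < y := by linarith
    have hlogy : Real.log y ≤ y / 2 := by
      have h1 : Real.log (y / 2) ≤ y / 2 - 1 := Real.log_le_sub_one_of_pos (by positivity)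
      rw [Real.log_div hy0.ne' two_ne_zero] at h1
      linarith [Real.log_two_lt_d9]
    have hlogy0 : 0 ≤ Real.log y := Real.log_nonneg hy1
    refine ⟨(n * y)⁻¹, by positivity, inv_le_one_of_one_le₀ (by nlinarith), ?_, ?_⟩
    · rw [mul_inv, mul_comm, ← mul_assoc, mul_inv_cancel₀ hn0.ne', one_mul]
      exact inv_le_one_of_one_le₀ hy1
    rw [inv_inv, Real.log_mul hn0.ne' hy0.ne', ← hy]
    have hpow : (1 + (n * y)⁻¹) ^ n ≤ 1 + 2 / y := by
      calc (1 + (n * y)⁻¹) ^ n ≤ Real.exp ((n * y)⁻¹) ^ n := by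
            have := Real.add_one_le_exp ((n * y)⁻¹)
            exact pow_le_pow_left₀ (by positivity) (by linarith) _
        _ = Real.exp (1 / y) := by
            rw [← Real.exp_nat_mul]; congr 1; field_simp
        _ ≤ 1 + 2 / y := by
            have hy' : |1 / y| ≤ 1 := by
              rw [abs_of_pos (by positivity)]; exact (div_le_one hy0).2 hy1
            have := (abs_le.1 (Real.abs_exp_sub_one_le hy')).2
            rw [abs_of_pos (by positivity)] at this
            have : 2 * (1 / y) = 2 / y := by ring
            linarith
    calc (1 + (n * y)⁻¹) ^ n * (n * (y + Real.log y) + 2)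
        ≤ (1 + 2 / y) * (n * (y + Real.log y) + 2) := by gcongr
      _ = n * y + n * Real.log y + 2 * n + 2 * n * (Real.log y / y) + 2 + 4 * (1 / y) := by
          field_simp; ring
      _ ≤ n * y + n * Real.log y + 2 * n + 2 * n * (1 / 2) + 2 + 4 * 1 := by
          have h1 : Real.log y / y ≤ 1 / 2 := by rw [div_le_iff₀ hy0]; linarith
          have h2 : 1 / y ≤ 1 := (div_le_one hy0).2 hy1
          exact add_le_add (add_le_add_left (add_le_add_right
            (mul_le_mul_of_nonneg_left h1 (by positivity)) _) _)
            (mul_le_mul_of_nonneg_left h2 (by norm_num))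
      -- `3n + 6 ≤ 5n` is where `n ≥ 3` is needed.
      _ ≤ _ := by linarith

/-! ### From the torus back to `K` -/

/-- A convex body has an interior translate `U` with `-U ⊆ n U`. -/
theorem Convex.exists_forall_neg_smul_mem_interior {E : Type*} [NormedAddCommGroup E]
    [NormedSpace ℝ E] [FiniteDimensional ℝ E] {K : Set E} (hK : Convex ℝ K)
    (hb : Bornology.IsBounded K) (hint : (interior K).Nonempty)
    (hn : 0 < Module.finrank ℝ E) :
    ∃ c : E, ∀ w, c + w ∈ interior K →
      c + -((Module.finrank ℝ E : ℝ)⁻¹ • w) ∈ interior K := by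
  obtain ⟨c, hc⟩ := hK.closure.exists_forall_reflection_mem
    (Metric.isCompact_of_isClosed_isBounded isClosed_closure hb.closure) hn
  set m : ℝ := (Module.finrank ℝ E : ℝ)
  have hm : 0 < m := by simpa [m] using hn
  refine ⟨c, fun w hw => ?_⟩
  -- The reflected, shrunken interior is open and lies in `closure K`, hence in the interior of
  -- `closure K`, which is that of `K`.
  have hopen : IsOpen (c +ᵥ (-m⁻¹) • ((-c) +ᵥ interior K)) :=
    ((isOpen_interior.vadd _).smul₀ (neg_ne_zero.2 (inv_ne_zero hm.ne'))).vadd _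
  have hsub : c +ᵥ (-m⁻¹) • ((-c) +ᵥ interior K) ⊆ closure K := by
    rintro _ ⟨_, ⟨_, ⟨x, hx, rfl⟩, rfl⟩, rfl⟩
    convert hc x (subset_closure (interior_subset hx)) using 1
    simp only [vadd_eq_add]
    rw [smul_sub, smul_smul, show m⁻¹ * (m + 1) = 1 + m⁻¹ by field_simp]
    module
  rw [← hK.interior_closure_eq_interior_of_nonempty_interior hint]
  refine interior_maximal hsub hopen ⟨_, ⟨_, ⟨_, hw, rfl⟩, rfl⟩, ?_⟩
  simp

theorem mainTheorem1 (n : ℕ) (hn : 2 ≤ n) (K : Set (EuclideanSpace ℝ (Fin n)))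
    (hconv : Convex ℝ K) (hbdd : Bornology.IsBounded K) (hint : (interior K).Nonempty) :
    periodicCoveringDensity K ≤
      ENNReal.ofReal (n * Real.log n + n * Real.log (Real.log n) + 5 * n) := by
  have hn0 : (0 : ℝ) < n := by exact_mod_cast (by omega : 0 < n)
  have hfr : Module.finrank ℝ (EuclideanSpace ℝ (Fin n)) = n := finrank_euclideanSpace_fin
  obtain ⟨η, hη, hη1, hηn, hbound⟩ := exists_enlargement_bound n hn
  obtain ⟨c, hc⟩ := hconv.exists_forall_neg_smul_mem_interior hbdd hint (by rw [hfr]; omega)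
  rw [hfr] at hc
  have h1η : 0 < 1 + η := by linarith
  set U : Set (EuclideanSpace ℝ (Fin n)) := (-c) +ᵥ interior K with hU
  have hmemU : ∀ w, w ∈ U ↔ c + w ∈ interior K := fun w => by
    simp [hU, Set.mem_vadd_set_iff_neg_vadd_mem]
  set W := (1 + η)⁻¹ • U with hWdef
  have hUW : (1 + η) • W = U := smul_inv_smul₀ h1η.ne' U
  have hWo : IsOpen W := (isOpen_interior.vadd _).smul₀ (inv_ne_zero h1η.ne')
  have hWc : Convex ℝ W := (hconv.interior.vadd _).smul _
  have hWne : W.Nonempty := hint.vadd_set.smul_set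
  have hWb : Bornology.IsBounded W := ((hbdd.subset interior_subset).vadd _).smul₀ _
  have hneg : ∀ w ∈ W, -((n : ℝ)⁻¹ • w) ∈ W := by
    rintro _ ⟨u, hu, rfl⟩
    refine ⟨-((n : ℝ)⁻¹ • u), (hmemU _).2 (hc u ((hmemU u).1 hu)), ?_⟩
    simp only [smul_neg]
    rw [smul_comm]
  obtain ⟨b, hb⟩ := hWb.exists_basis_span_inter_sub
  set Λ := Submodule.span ℤ (Set.range b)
  set F := ZSpan.fundamentalDomain b
  have hF : IsAddFundamentalDomain Λ F volume := ZSpan.isAddFundamentalDomain b volume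
  have hFt : volume F ≠ ⊤ := (ZSpan.fundamentalDomain_isBounded b).measure_lt_top.ne
  have hF0 : 0 < (volume : Measure (EuclideanSpace ℝ (Fin n))).real F :=
    ENNReal.toReal_pos (ZSpan.measure_fundamentalDomain_ne_zero b) hFt
  obtain ⟨T, hcov, hcard⟩ := exists_finset_cover_card_mul_le hF
    (ZSpan.fundamentalDomain_measurableSet b) hFt hWo hWc hWne hn0 hneg hb hη hη1 hηn
  rw [hUW] at hcov
  rw [hfr] at hcard
  refine sInf_le_of_le ⟨Λ, inferInstance, inferInstance, T, ?_, rfl⟩ ?_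
  · refine Set.eq_univ_of_forall fun x => ?_
    obtain ⟨t, ht, v, hv, h⟩ := hcov (x - c)
    refine Set.mem_iUnion.2 ⟨(⟨v, hv⟩, ⟨t, ht⟩), ?_⟩
    refine ⟨_, interior_subset ((hmemU _).1 h), ?_⟩
    simp only [vadd_eq_add]
    abel
  -- A convex set has null frontier, so passing to the interior costs no volume.
  · have hKU : volume K = volume U := by
      rw [hU, measure_vadd, measure_interior_of_null_frontier (hconv.addHaar_frontier volume)]
    have hUt : volume U ≠ ⊤ := by
      rw [← hKU]; exact hbdd.measure_lt_top.ne
    have hW : volume.real U = (1 + η) ^ n * volume.real W := by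
      rw [← hUW, Measure.real, Measure.addHaar_smul, ENNReal.toReal_mul, hfr,
        abs_of_pos (by positivity), ENNReal.toReal_ofReal (by positivity), Measure.real]
    rw [periodicDensity, hKU, ZLattice.covolume_eq_measure_fundamentalDomain Λ volume hF,
      ← ENNReal.ofReal_toReal hUt, ← ENNReal.ofReal_natCast, ← ENNReal.ofReal_mul (by positivity),
      ← ENNReal.ofReal_div_of_pos hF0]
    refine ENNReal.ofReal_le_ofReal (le_trans ?_ hbound)
    change T.card * volume.real U / volume.real F ≤ _
    rw [hW]
    calc _ = (1 + η) ^ n * (T.card * (volume.real W / volume.real F)) := by ring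
      _ ≤ _ := by gcongr
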